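/- For real Hurwitz $2\times 2$ matrices $A,B$ (all eigenvalues have negative real part) consider the planar switched system $$\dot x(t)=u(t)Ax(t)+(1-u(t))Bx(t),\qquad x\in\mathbb{R}^2,$$ where $u:[0,\infty)\to U$ is an arbitrary measurable function and $U$ is either $[0,1]$ or $\{0,1\}$ (the statement holds for each of the two choices). The system is GUES (globally uniformly exponentially stable) if there are constants $M,\lambda>0$ such that $\|x(t)\|\le Me^{-\lambda t}\|x(0)\|$ for all $t>0$, all such $u$ and all solutions $x$. A common Lyapunov function (CLF) of the system is a continuous function $V:\mathbb{R}^2\to\mathbb{R}$ with $V(0)=0$ and $V(x)>0$ for $x\neq 0$ that is strictly decreasing along every nonconstant trajectory. Let $\Xi_{GUES}$ be the set of pairs $(A,B)$ of Hurwitz matrices whose system is GUES. Then every $(A,B)\in\Xi_{GUES}$ admits a polynomial CLF, so that the minimum $m(A,B)$ of the degrees of its polynomial CLFs exists, and $m(A,B)$ is not bounded uniformly over $\Xi_{GUES}$: there is no $m\in\mathbb{N}$ with $m(A,B)\le m$ for all $(A,B)\in\Xi_{GUES}$. Equivalently, for every $m\in\mathbb{N}$, the set of polynomials of degree at most $m$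 is not sufficient to check GUES for this class: some $(A,B)\in\Xi_{GUES}$ has no CLF that is a polynomial of degree at most $m$. -/

import Mathlib

namespace PlanarSwitched

/-- The state space `ℝ²` with the Euclidean norm. -/
abbrev Plane : Type := EuclideanSpace ℝ (Fin 2)

/-- Real `2 × 2` matrices. -/
abbrev Mat : Type := Matrix (Fin 2) (Fin 2) ℝ

/-- A matrix is Hurwitz if all its complex eigenvalues have negative real part. -/
def IsHurwitz (A : Mat) : Prop :=
  ∀ z ∈ spectrum ℂ (A.map Complex.ofReal), z.re < 0

/-- The matrix `u A + (1 - u) B`. -/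
def mix (A B : Mat) (u : ℝ) : Mat := u • A + (1 - u) • B

/-- Switching functions: measurable functions taking values in `U` on `[0, ∞)`
(their values at negative times play no role). -/
def IsSwitching (U : Set ℝ) (u : ℝ → ℝ) : Prop :=
  Measurable u ∧ ∀ t, 0 ≤ t → u t ∈ U

/-- `x` is the Carathéodory solution on `[0, ∞)` of `x' = u A x + (1 - u) B x` for the switching
function `u`, written in integral form. The integrand is locally integrable on `[0, ∞)` when `u` is
measurable and bounded there and `x` is continuous there. -/
def IsSolution (A B : Mat) (u : ℝ → ℝ) (x : ℝ → Plane) : Prop :=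
  ContinuousOn x (Set.Ici 0) ∧
    ∀ t, 0 ≤ t → x t = x 0 + ∫ s in (0 : ℝ)..t, Matrix.toEuclideanLin (mix A B (u s)) (x s)

/-- Trajectories of the switched system: solutions for some switching function. -/
def IsTrajectory (U : Set ℝ) (A B : Mat) (x : ℝ → Plane) : Prop :=
  ∃ u : ℝ → ℝ, IsSwitching U u ∧ IsSolution A B u x

/-- Global uniform exponential stability: the constants `M`, `lam` serve all initial conditions
and all switching functions. -/
def IsGUES (U : Set ℝ) (A B : Mat) : Prop :=
  ∃ M lam : ℝ, 0 < M ∧ 0 < lam ∧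
    ∀ x : ℝ → Plane, IsTrajectory U A B x →
      ∀ t, 0 < t → ‖x t‖ ≤ M * Real.exp (-lam * t) * ‖x 0‖

/-- Common Lyapunov functions: continuous, positive definite, and strictly decreasing along every
nonconstant trajectory of the switched system. -/
def IsCLF (U : Set ℝ) (A B : Mat) (V : Plane → ℝ) : Prop :=
  Continuous V ∧ V 0 = 0 ∧ (∀ x, x ≠ 0 → 0 < V x) ∧
    ∀ x : ℝ → Plane, IsTrajectory U A B x → (¬ ∃ c : Plane, ∀ t, 0 ≤ t → x t = c) →
      StrictAntiOn (fun t => V (x t)) (Set.Ici 0)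

/-- The pairs of Hurwitz matrices whose switched system is GUES. -/
def XiGUES (U : Set ℝ) : Set (Mat × Mat) :=
  {S | IsHurwitz S.1 ∧ IsHurwitz S.2 ∧ IsGUES U S.1 S.2}

/-- The polynomial function on the plane given by a polynomial in two variables. -/
noncomputable def polyFun (p : MvPolynomial (Fin 2) ℝ) : Plane → ℝ :=
  fun x => MvPolynomial.eval (fun i => x i) p

/-- The degrees of the polynomial common Lyapunov functions of a switched system. -/
def polyCLFDegrees (U : Set ℝ) (A B : Mat) : Set ℕ :=
  {d | ∃ p : MvPolynomial (Fin 2) ℝ, IsCLF U A B (polyFun p) ∧ p.totalDegree = d}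

/-- The least degree of a polynomial common Lyapunov function (it is attained as soon as there is
such a function). -/
noncomputable def minDegree (U : Set ℝ) (A B : Mat) : ℕ := sInf (polyCLFDegrees U A B)

/-- The polynomial functions on the plane of degree at most `m`. -/
def polyOfDegreeLE (m : ℕ) : Set (Plane → ℝ) :=
  {V | ∃ p : MvPolynomial (Fin 2) ℝ, p.totalDegree ≤ m ∧ V = polyFun p}

/-- A set of functions is sufficient to check GUES if every GUES system of the class has a common
Lyapunov function in that set. -/
def SufficientToCheckGUES (U : Set ℝ) (F : Set (Plane → ℝ)) : Prop :=
  ∀ A B : Mat, (A, B) ∈ XiGUES U → ∃ V ∈ F, IsCLF U A B V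

end PlanarSwitched

namespace PlanarSwitched

open MeasureTheory Filter Topology Set

/-! Existence. Given GUES with rate `lam`, let C be the set of points whose trajectories satisfy
`exp (lam * t) * ‖y t‖ ≤ 1`, and let K be its polar. GUES makes K compact, and K contains the unit
ball. Concatenation of trajectories shows that `exp (lam * τ) • exp (τ • L)` preserves C for L = A,
B, so its adjoint S preserves K. Set V(x) = ∫ over K of ⟪l, x⟫ ^ (2k), a homogeneous polynomial. The
change of variables S, together with S(K) ⊆ K, gives det S · exp(2k lam τ) · V(exp(τL) x) ≤ V(x). At
τ = 0 this differentiates to DV(x)(Lx) ≤ -(c + 2k lam) V(x), with c independent of k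
(`IsFlow.exists_fderiv_momentPoly_le`), so a large k gives decay along both fields.

Unboundedness. One field contracts horizontal lines to the diagonal, the other vertical lines to the
antidiagonal. Undamped, they run around every square with vertices (±s, ±s), which forces a
nonincreasing polynomial to be constant (`eq_zero_of_contraction_le`). With any damping e > 0 the
pair is GUES, as shown by x₀ⁿ + x₁ⁿ with n even and ne > 1. If degree m sufficed for all e > 0,
normalized coefficient vectors would accumulate as e → 0 at a nonzero polynomial for the undamped
pair, a contradiction.

Both choices of U are treated together: estimates along trajectories hold for all u in [0,1], and
only the constant controls 0 and 1 and concatenations are used to produce trajectories. -/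

/-- The continuous linear map of the plane given by a matrix. -/
noncomputable abbrev planeMap (A : Mat) : Plane →L[ℝ] Plane :=
  Matrix.toEuclideanCLM (n := Fin 2) (𝕜 := ℝ) A

/-! ### Differential inequalities along trajectories -/

theorem toEuclideanLin_mix (A B : Mat) (u : ℝ) (x : Plane) :
    Matrix.toEuclideanLin (mix A B u) x = u • planeMap A x + (1 - u) • planeMap B x := by
  rw [mix, map_add, map_smul, map_smul]
  rfl

theorem norm_toEuclideanLin_mix_le (A B : Mat) {u : ℝ} (hu : u ∈ Icc (0 : ℝ) 1) (x : Plane) :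
    ‖Matrix.toEuclideanLin (mix A B u) x‖ ≤ (‖planeMap A‖ + ‖planeMap B‖) * ‖x‖ := by
  rw [toEuclideanLin_mix, add_mul]
  refine (norm_add_le _ _).trans (add_le_add ?_ ?_)
  · rw [norm_smul, Real.norm_of_nonneg hu.1]
    exact (mul_le_of_le_one_left (norm_nonneg _) hu.2).trans ((planeMap A).le_opNorm x)
  · rw [norm_smul, Real.norm_of_nonneg (sub_nonneg.2 hu.2)]
    exact (mul_le_of_le_one_left (norm_nonneg _) (by linarith [hu.1])).trans
      ((planeMap B).le_opNorm x)

theorem intervalIntegrable_mix {A B : Mat} {u : ℝ → ℝ} {x : ℝ → Plane}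
    (hu : IsSwitching (Icc 0 1) u) (hx : ContinuousOn x (Ici 0)) {a b : ℝ} (ha : 0 ≤ a)
    (hab : a ≤ b) :
    IntervalIntegrable (fun s => Matrix.toEuclideanLin (mix A B (u s)) (x s)) volume a b := by
  rw [intervalIntegrable_iff_integrableOn_Ioc_of_le hab]
  have hsub : Ioc a b ⊆ Ici 0 := fun s hs => ha.trans hs.1.le
  have key : ∀ (L : Plane →L[ℝ] Plane) (v : ℝ → ℝ), Measurable v →
      (∀ s, 0 ≤ s → v s ∈ Icc (0 : ℝ) 1) →
      IntegrableOn (fun s => v s • L (x s)) (Ioc a b) := by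
    intro L v hv hv1
    have hc : IntegrableOn (fun s => L (x s)) (Ioc a b) :=
      ((L.continuous.comp_continuousOn
        (hx.mono fun s hs => ha.trans hs.1)).integrableOn_Icc).mono_set Ioc_subset_Icc_self
    refine Integrable.mono hc (hv.aestronglyMeasurable.smul hc.aestronglyMeasurable) ?_
    filter_upwards [ae_restrict_mem measurableSet_Ioc] with s hs
    have h := hv1 s (hsub hs)
    rw [norm_smul, Real.norm_of_nonneg h.1]
    exact mul_le_of_le_one_left (norm_nonneg _) h.2
  simp only [toEuclideanLin_mix]
  refine Integrable.add (key _ _ hu.1 hu.2) (key _ (fun s => 1 - u s) (hu.1.const_sub 1) ?_)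
  intro s hs
  have := hu.2 s hs
  exact ⟨by linarith [this.2], by linarith [this.1]⟩

theorem IsSolution.sub_eq_integral {A B : Mat} {u : ℝ → ℝ} {x : ℝ → Plane}
    (hu : IsSwitching (Icc 0 1) u) (hx : IsSolution A B u x) {a b : ℝ} (ha : 0 ≤ a)
    (hab : a ≤ b) :
    x b - x a = ∫ s in a..b, Matrix.toEuclideanLin (mix A B (u s)) (x s) := by
  rw [hx.2 b (ha.trans hab), hx.2 a ha, ← intervalIntegral.integral_add_adjacent_intervals
    (intervalIntegrable_mix hu hx.1 le_rfl ha) (intervalIntegrable_mix hu hx.1 ha hab)]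
  abel

/-- The upper right Dini derivative of `Q` along a trajectory is at most the larger of the
derivatives of `Q` in the directions of the two vector fields. -/
theorem IsSolution.eventually_slope_lt {A B : Mat} {u : ℝ → ℝ} {x : ℝ → Plane}
    (hu : IsSwitching (Icc 0 1) u) (hx : IsSolution A B u x) {Q : Plane → ℝ} {t m r : ℝ}
    (ht : 0 ≤ t) (hQ : DifferentiableAt ℝ Q (x t))
    (hA : fderiv ℝ Q (x t) (planeMap A (x t)) ≤ m)
    (hB : fderiv ℝ Q (x t) (planeMap B (x t)) ≤ m) (hmr : m < r) :
    ∀ᶠ z in 𝓝[>] t, (z - t)⁻¹ * (Q (x z) - Q (x t)) < r := by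
  set L := fderiv ℝ Q (x t) with hL
  set N := ‖planeMap A‖ + ‖planeMap B‖
  have hN : 0 ≤ N := by positivity
  -- Lipschitz bound for x just after t, where ‖x s‖ < ‖x t‖ + 1; the final + 1 makes it positive.
  set C := N * (‖x t‖ + 1) + 1 with hC
  have hC0 : 0 < C := by positivity
  -- One η pays for the variation of the fields near x t, one for the linearization error of Q, and
  -- the third keeps the inequality strict.
  set η := (r - m) / 3 with hη
  have hη0 : 0 < η := by rw [hη]; linarith
  have hcont : Tendsto x (𝓝[≥] t) (𝓝 (x t)) :=
    (hx.1 t ht).mono_left (nhdsWithin_mono _ (Ici_subset_Ici.2 ht))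
  have hLA : ∀ᶠ s in 𝓝[≥] t, L (planeMap A (x s)) < m + η :=
    ((((L.comp (planeMap A)).continuous.tendsto (x t)).comp hcont).eventually_lt_const
      (show L (planeMap A (x t)) < m + η by linarith))
  have hLB : ∀ᶠ s in 𝓝[≥] t, L (planeMap B (x s)) < m + η :=
    ((((L.comp (planeMap B)).continuous.tendsto (x t)).comp hcont).eventually_lt_const
      (show L (planeMap B (x t)) < m + η by linarith))
  have hnorm : ∀ᶠ s in 𝓝[≥] t, ‖x s‖ < ‖x t‖ + 1 :=
    hcont.norm.eventually_lt_const (by linarith)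
  obtain ⟨δ, hδ, hδs⟩ := mem_nhdsGE_iff_exists_Ico_subset.1 (hLA.and (hLB.and hnorm))
  have hsmall := (hQ.hasFDerivAt.isLittleO.def (c := η / C) (by positivity))
  have hsmall' : ∀ᶠ z in 𝓝[>] t, ‖Q (x z) - Q (x t) - L (x z - x t)‖ ≤ η / C * ‖x z - x t‖ :=
    (hcont.mono_left (nhdsWithin_mono _ Ioi_subset_Ici_self)).eventually hsmall
  filter_upwards [hsmall', Ioo_mem_nhdsGT hδ] with z hz hzδ
  have htz : t < z := hzδ.1
  have hz0 : 0 < z - t := sub_pos.2 htz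
  have hint := intervalIntegrable_mix (A := A) (B := B) hu hx.1 ht htz.le
  have hdiff := hx.sub_eq_integral hu ht htz.le
  have hs : ∀ s ∈ Icc t z, L (planeMap A (x s)) < m + η ∧ L (planeMap B (x s)) < m + η ∧
      ‖x s‖ < ‖x t‖ + 1 := fun s hs => hδs ⟨hs.1, hs.2.trans_lt hzδ.2⟩
  have h1 : ‖x z - x t‖ ≤ C * (z - t) := by
    rw [hdiff]
    have := intervalIntegral.norm_integral_le_of_norm_le_const (a := t) (b := z) (C := C)
      (f := fun s => Matrix.toEuclideanLin (mix A B (u s)) (x s)) ?_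
    · rwa [abs_of_pos hz0] at this
    · intro s hs'
      rw [uIoc_of_le htz.le] at hs'
      have h2 := (hs s (Ioc_subset_Icc_self hs')).2.2
      refine (norm_toEuclideanLin_mix_le A B (hu.2 s (ht.trans hs'.1.le)) (x s)).trans ?_
      nlinarith [mul_le_mul_of_nonneg_left h2.le hN]
  have h2 : L (x z - x t) ≤ (m + η) * (z - t) := by
    rw [hdiff, ← L.intervalIntegral_comp_comm hint]
    have : ∫ s in t..z, L (Matrix.toEuclideanLin (mix A B (u s)) (x s)) ≤
        ∫ _ in t..z, (m + η) := by
      refine intervalIntegral.integral_mono_on htz.le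
        ⟨L.integrable_comp hint.1, L.integrable_comp hint.2⟩ intervalIntegrable_const ?_
      intro s hs'
      have hus := hu.2 s (ht.trans hs'.1)
      obtain ⟨ha, hb, -⟩ := hs s hs'
      rw [toEuclideanLin_mix, map_add, map_smul, map_smul, smul_eq_mul, smul_eq_mul]
      nlinarith [mul_le_mul_of_nonneg_left ha.le hus.1,
        mul_le_mul_of_nonneg_left hb.le (sub_nonneg.2 hus.2)]
    rw [intervalIntegral.integral_const, smul_eq_mul] at this
    linarith
  have h3 : Q (x z) - Q (x t) ≤ (m + 2 * η) * (z - t) := by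
    have h4 := (le_abs_self _).trans hz
    have h5 : η / C * ‖x z - x t‖ ≤ η * (z - t) := by
      calc η / C * ‖x z - x t‖ ≤ η / C * (C * (z - t)) := by gcongr
        _ = η * (z - t) := by field_simp
    linarith
  rw [inv_mul_lt_iff₀ hz0]
  have : m + 2 * η < r := by rw [hη]; linarith
  nlinarith

/-- A differential inequality for `Q` along both vector fields integrates to an exponential
estimate along all trajectories. -/
theorem IsSolution.le_exp_mul {A B : Mat} {u : ℝ → ℝ} {x : ℝ → Plane}
    (hu : IsSwitching (Icc 0 1) u) (hx : IsSolution A B u x) {Q : Plane → ℝ} {K : ℝ}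
    (hQ : Differentiable ℝ Q) (hA : ∀ y, fderiv ℝ Q y (planeMap A y) ≤ K * Q y)
    (hB : ∀ y, fderiv ℝ Q y (planeMap B y) ≤ K * Q y) {s t : ℝ} (hs : 0 ≤ s) (hst : s ≤ t) :
    Q (x t) ≤ Q (x s) * Real.exp (K * (t - s)) := by
  rw [← gronwallBound_ε0]
  refine le_gronwallBound_of_liminf_deriv_right_le (f := fun t => Q (x t))
    (f' := fun t => K * Q (x t)) (b := t) ?_ ?_ le_rfl (fun y _ => by simp) t ⟨hst, le_rfl⟩
  · exact hQ.continuous.comp_continuousOn (hx.1.mono fun y hy => hs.trans hy.1)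
  · intro y hy r hr
    exact (hx.eventually_slope_lt hu (hs.trans hy.1) (hQ _) (hA _) (hB _) hr).frequently

/-- A nonzero trajectory does not reach the origin in finite time. -/
theorem IsSolution.ne_zero_of_le {A B : Mat} {u : ℝ → ℝ} {x : ℝ → Plane}
    (hu : IsSwitching (Icc 0 1) u) (hx : IsSolution A B u x) {s t : ℝ} (hs : 0 ≤ s)
    (hst : s ≤ t) (h0 : x s ≠ 0) : x t ≠ 0 := by
  set N := ‖planeMap A‖ + ‖planeMap B‖
  -- Negating the squared norm turns the upper Grönwall estimate into a lower bound on ‖x t‖.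
  have hd : ∀ y : Plane, HasFDerivAt (fun y : Plane => -‖y‖ ^ 2) (-(2 • innerSL ℝ y)) y :=
    fun y => (hasStrictFDerivAt_norm_sq y).hasFDerivAt.neg
  have hbound : ∀ L : Plane →L[ℝ] Plane, ‖L‖ ≤ N → ∀ y,
      fderiv ℝ (fun y : Plane => -‖y‖ ^ 2) y (L y) ≤ (-2 * N) * (-‖y‖ ^ 2) := by
    intro L hL y
    rw [(hd y).fderiv]
    have h1 : |inner ℝ y (L y)| ≤ ‖y‖ * (N * ‖y‖) :=
      (abs_real_inner_le_norm _ _).trans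
        (mul_le_mul_of_nonneg_left (L.le_of_opNorm_le hL y) (norm_nonneg _))
    have h2 := (neg_le_abs _).trans h1
    simp only [neg_apply, smul_apply, innerSL_apply_apply,
      nsmul_eq_mul, Nat.cast_ofNat]
    linarith
  have := hx.le_exp_mul hu (fun y => (hd y).differentiableAt)
    (hbound _ (le_add_of_nonneg_right (norm_nonneg _)))
    (hbound _ (le_add_of_nonneg_left (norm_nonneg _))) hs hst
  intro h
  simp only [h, norm_zero] at this
  have h1 : 0 < ‖x s‖ ^ 2 * Real.exp (-2 * N * (t - s)) := by positivity
  linarith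

/-- A solution that vanishes at some time vanishes afterwards. -/
theorem IsSolution.eq_zero_of_le {A B : Mat} {u : ℝ → ℝ} {x : ℝ → Plane}
    (hu : IsSwitching (Icc 0 1) u) (hx : IsSolution A B u x) {V : Plane → ℝ} {K : ℝ}
    (hV : Differentiable ℝ V) (h0 : V 0 = 0) (hpos : ∀ y, y ≠ 0 → 0 < V y)
    (hA : ∀ y, fderiv ℝ V y (planeMap A y) ≤ K * V y)
    (hB : ∀ y, fderiv ℝ V y (planeMap B y) ≤ K * V y) {s t : ℝ} (hs : 0 ≤ s)
    (hst : s ≤ t) (h : x s = 0) : x t = 0 := by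
  by_contra hne
  have := hx.le_exp_mul hu hV hA hB hs hst
  rw [h, h0, zero_mul] at this
  exact absurd (hpos _ hne) this.not_gt

/-- The exponential estimate is strict only where V > 0, so the point is that a nonconstant
trajectory never meets the origin: from 0 it would stay there, and from elsewhere it cannot reach 0.
-/
theorem isCLF_of_fderiv_le {U : Set ℝ} (hU : U ⊆ Icc 0 1) {A B : Mat} {V : Plane → ℝ} {c : ℝ}
    (hc : 0 < c) (hV : Differentiable ℝ V) (h0 : V 0 = 0) (hpos : ∀ y, y ≠ 0 → 0 < V y)
    (hA : ∀ y, fderiv ℝ V y (planeMap A y) ≤ -c * V y)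
    (hB : ∀ y, fderiv ℝ V y (planeMap B y) ≤ -c * V y) : IsCLF U A B V := by
  refine ⟨hV.continuous, h0, hpos, ?_⟩
  rintro x ⟨u, hu, hx⟩ hnc s hs t ht hst
  have hu' : IsSwitching (Icc 0 1) u := ⟨hu.1, fun t ht => hU (hu.2 t ht)⟩
  have hs0 : (0 : ℝ) ≤ s := hs
  have hxs : x s ≠ 0 := by
    refine hx.ne_zero_of_le hu' le_rfl hs0 fun h => hnc ⟨0, fun r hr => ?_⟩
    exact hx.eq_zero_of_le hu' hV h0 hpos hA hB le_rfl hr h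
  refine (hx.le_exp_mul hu' hV hA hB hs0 hst.le).trans_lt ?_
  refine mul_lt_of_lt_one_right (hpos _ hxs) (Real.exp_lt_one_iff.2 ?_)
  nlinarith

/-! ### Exponential flows and concatenation -/

theorem hasDerivAt_exp_smul_apply (L : Plane →L[ℝ] Plane) (x : Plane) (t : ℝ) :
    HasDerivAt (fun s : ℝ => NormedSpace.exp (s • L) x) (L (NormedSpace.exp (t • L) x)) t := by
  have := (hasDerivAt_exp_smul_const' (𝕂 := ℝ) L t).clm_apply (hasDerivAt_const t x)
  simpa using this

theorem exp_zero_smul_apply (L : Plane →L[ℝ] Plane) (x : Plane) :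
    NormedSpace.exp ((0 : ℝ) • L) x = x := by
  rw [zero_smul ℝ L, NormedSpace.exp_zero]
  rfl

theorem isSolution_of_hasDerivAt {A B : Mat} {c : ℝ} {x : ℝ → Plane}
    (hx : ∀ t, HasDerivAt x (c • planeMap A (x t) + (1 - c) • planeMap B (x t)) t) :
    IsSolution A B (fun _ => c) x := by
  have hcont : Continuous x := continuous_iff_continuousAt.2 fun t => (hx t).continuousAt
  refine ⟨hcont.continuousOn, fun t _ => ?_⟩
  simp only [toEuclideanLin_mix]
  rw [intervalIntegral.integral_eq_sub_of_hasDerivAt (fun s _ => hx s)]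
  · abel
  · apply Continuous.intervalIntegrable
    fun_prop

theorem isSwitching_const {U : Set ℝ} {c : ℝ} (hc : c ∈ U) : IsSwitching U fun _ => c :=
  ⟨measurable_const, fun _ _ => hc⟩

theorem IsTrajectory.const_smul {U : Set ℝ} {A B : Mat} {x : ℝ → Plane}
    (hx : IsTrajectory U A B x) (c : ℝ) : IsTrajectory U A B fun t => c • x t := by
  obtain ⟨u, hu, hc, hx⟩ := hx
  refine ⟨u, hu, hc.const_smul c, fun t ht => ?_⟩
  simp only [map_smul, intervalIntegral.integral_smul]
  rw [← smul_add, ← hx t ht]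

/-- Concatenation of two trajectories at a time `a`. -/
theorem IsTrajectory.concat {U : Set ℝ} (hU : U ⊆ Icc 0 1) {A B : Mat} {x y : ℝ → Plane}
    (hx : IsTrajectory U A B x) (hy : IsTrajectory U A B y) {a : ℝ} (ha : 0 ≤ a)
    (hxy : y 0 = x a) : IsTrajectory U A B fun t => if t ≤ a then x t else y (t - a) := by
  obtain ⟨u, hu, hx⟩ := hx
  obtain ⟨v, hv, hy⟩ := hy
  have hu' : IsSwitching (Icc 0 1) u := ⟨hu.1, fun t ht => hU (hu.2 t ht)⟩
  have hv' : IsSwitching (Icc 0 1) v := ⟨hv.1, fun t ht => hU (hv.2 t ht)⟩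
  set w : ℝ → ℝ := fun t => if t ≤ a then u t else v (t - a) with hw
  set z : ℝ → Plane := fun t => if t ≤ a then x t else y (t - a) with hz
  have hwS : IsSwitching U w := by
    refine ⟨Measurable.ite measurableSet_Iic hu.1 (hv.1.comp (measurable_id.sub_const a)), ?_⟩
    intro t ht
    by_cases h : t ≤ a
    · simpa [hw, h] using hu.2 t ht
    · simpa [hw, h] using hv.2 (t - a) (by linarith)
  have hzc : ContinuousOn z (Ici 0) := by
    refine ContinuousOn.if ?_ ?_ ?_
    · rintro t ⟨-, ht⟩
      rw [show {t | t ≤ a} = Iic a from rfl, frontier_Iic] at ht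
      rw [mem_singleton_iff.1 ht, sub_self, hxy]
    · exact hx.1.mono inter_subset_left
    · refine hy.1.comp (by fun_prop) ?_
      rintro t ⟨-, ht⟩
      have : closure {t | ¬ t ≤ a} ⊆ Ici a :=
        closure_minimal (fun s hs => (not_le.1 hs).le) isClosed_Ici
      exact mem_Ici.2 (sub_nonneg.2 (mem_Ici.1 (this ht)))
  refine ⟨w, hwS, hzc, fun t ht => ?_⟩
  have hz0 : z 0 = x 0 := by simp [hz, ha]
  have hfirst : ∀ r, 0 ≤ r → r ≤ a →
      ∫ s in (0 : ℝ)..r, Matrix.toEuclideanLin (mix A B (w s)) (z s) = x r - x 0 := by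
    intro r hr hra
    rw [hx.sub_eq_integral hu' le_rfl hr]
    refine intervalIntegral.integral_congr fun s hs => ?_
    rw [uIcc_of_le hr] at hs
    simp [hw, hz, hs.2.trans hra]
  have hwI : IsSwitching (Icc 0 1) w := ⟨hwS.1, fun t ht => hU (hwS.2 t ht)⟩
  rcases le_or_gt t a with h | h
  · rw [hfirst t ht h, hz0]
    simp [hz, h]
  · rw [← intervalIntegral.integral_add_adjacent_intervals
      (intervalIntegrable_mix hwI hzc le_rfl ha) (intervalIntegrable_mix hwI hzc ha h.le),
      hfirst a ha le_rfl, hz0]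
    have h2 : ∫ s in a..t, Matrix.toEuclideanLin (mix A B (w s)) (z s) =
        ∫ s in a..t, Matrix.toEuclideanLin (mix A B (v (s - a))) (y (s - a)) := by
      -- The integrands may differ at s = a, where w still follows u; the half-open interval avoids
      -- this point.
      refine intervalIntegral.integral_congr_ae (Eventually.of_forall fun s hs => ?_)
      rw [uIoc_of_le h.le] at hs
      simp [hw, hz, hs.1.not_ge]
    rw [h2, intervalIntegral.integral_comp_sub_right
      (fun s => Matrix.toEuclideanLin (mix A B (v s)) (y s)), sub_self,
      ← hy.sub_eq_integral hv' le_rfl (sub_pos.2 h).le, hxy]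
    simp [hz, h.not_ge]

/-! ### The stable set and its polar -/

/-- Initial points all of whose trajectories stay in the unit ball when rescaled by the growing
factor `exp (lam * t)`. -/
def stableSet (U : Set ℝ) (A B : Mat) (lam : ℝ) : Set Plane :=
  {x | ∀ y : ℝ → Plane, IsTrajectory U A B y → y 0 = x →
    ∀ t, 0 ≤ t → Real.exp (lam * t) * ‖y t‖ ≤ 1}

/-- The polar set of `stableSet`. -/
def stablePolar (U : Set ℝ) (A B : Mat) (lam : ℝ) : Set Plane :=
  {l | ∀ x ∈ stableSet U A B lam, |inner ℝ l x| ≤ 1}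

/-- A linear map whose exponential flow consists of trajectories. -/
def IsFlow (U : Set ℝ) (A B : Mat) (L : Plane →L[ℝ] Plane) : Prop :=
  ∀ x : Plane, IsTrajectory U A B fun t => NormedSpace.exp (t • L) x

theorem isFlow_left {U : Set ℝ} (hU : (1 : ℝ) ∈ U) (A B : Mat) : IsFlow U A B (planeMap A) :=
  fun x => ⟨fun _ => 1, isSwitching_const hU, isSolution_of_hasDerivAt fun t => by
    simpa using hasDerivAt_exp_smul_apply (planeMap A) x t⟩

theorem isFlow_right {U : Set ℝ} (hU : (0 : ℝ) ∈ U) (A B : Mat) : IsFlow U A B (planeMap B) :=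
  fun x => ⟨fun _ => 0, isSwitching_const hU, isSolution_of_hasDerivAt fun t => by
    simpa using hasDerivAt_exp_smul_apply (planeMap B) x t⟩

/-- Running the flow for time τ and then a rescaled trajectory y is a trajectory from x; its bound
at time t + τ is the bound for y at time t. -/
theorem IsFlow.smul_exp_mem {U : Set ℝ} (hU : U ⊆ Icc 0 1) {A B : Mat} {L : Plane →L[ℝ] Plane}
    (hL : IsFlow U A B L) {lam τ : ℝ} (hτ : 0 ≤ τ) {x : Plane} (hx : x ∈ stableSet U A B lam) :
    Real.exp (lam * τ) • NormedSpace.exp (τ • L) x ∈ stableSet U A B lam := by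
  intro y hy hy0 t ht
  have hc := (hL x).concat hU (hy.const_smul (Real.exp (lam * τ))⁻¹) hτ (by
    simp only [hy0]
    rw [smul_smul, inv_mul_cancel₀ (Real.exp_pos _).ne', one_smul])
  have h := hx _ hc (by simp [hτ, exp_zero_smul_apply]) (t + τ) (by linarith)
  have hval : (if t + τ ≤ τ then NormedSpace.exp ((t + τ) • L) x
      else (Real.exp (lam * τ))⁻¹ • y (t + τ - τ)) = (Real.exp (lam * τ))⁻¹ • y t := by
    split_ifs with h'
    · have ht0 : t = 0 := by linarith
      rw [ht0, hy0, smul_smul, inv_mul_cancel₀ (Real.exp_pos _).ne', one_smul, zero_add]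
    · rw [add_sub_cancel_right]
  rw [hval, norm_smul, norm_inv, Real.norm_of_nonneg (Real.exp_pos _).le, mul_add, Real.exp_add,
    mul_assoc, mul_inv_cancel_left₀ (Real.exp_pos _).ne'] at h
  exact h

theorem IsFlow.norm_le_one {U : Set ℝ} {A B : Mat} {L : Plane →L[ℝ] Plane}
    (hL : IsFlow U A B L) {lam : ℝ} {x : Plane} (hx : x ∈ stableSet U A B lam) : ‖x‖ ≤ 1 := by
  simpa [exp_zero_smul_apply] using hx _ (hL x) (exp_zero_smul_apply L x) 0 le_rfl

theorem isClosed_stablePolar (U : Set ℝ) (A B : Mat) (lam : ℝ) :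
    IsClosed (stablePolar U A B lam) := by
  have : stablePolar U A B lam = ⋂ x ∈ stableSet U A B lam, {l | |inner ℝ l x| ≤ 1} := by
    ext l
    simp [stablePolar]
  rw [this]
  exact isClosed_biInter fun x _ =>
    isClosed_le (continuous_id.inner continuous_const).abs continuous_const

theorem ball_subset_stablePolar {U : Set ℝ} {A B : Mat} {L : Plane →L[ℝ] Plane}
    (hL : IsFlow U A B L) (lam : ℝ) : Metric.ball 0 1 ⊆ stablePolar U A B lam := by
  intro l hl x hx
  refine (abs_real_inner_le_norm l x).trans ?_
  have := mem_ball_zero_iff.1 hl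
  exact mul_le_one₀ this.le (norm_nonneg _) (hL.norm_le_one hx)

/-- The stable set contains every vector of norm 1 / (M + 1), so its polar lies in the ball of
radius M + 1. Using M + 1 instead of M also covers t = 0, where the hypothesis says nothing. -/
theorem isCompact_stablePolar {U : Set ℝ} {A B : Mat} {M lam : ℝ} (hM : 0 < M)
    (h : ∀ x : ℝ → Plane, IsTrajectory U A B x →
      ∀ t, 0 < t → ‖x t‖ ≤ M * Real.exp (-lam * t) * ‖x 0‖) :
    IsCompact (stablePolar U A B lam) := by
  have hM1 : 0 < M + 1 := by linarith
  refine Metric.isCompact_of_isClosed_isBounded (isClosed_stablePolar U A B lam)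
    (isBounded_iff_forall_norm_le.2 ⟨M + 1, fun l hl => ?_⟩)
  rcases eq_or_ne l 0 with rfl | h0
  · simpa using hM1.le
  have hl0 : 0 < ‖l‖ := norm_pos_iff.2 h0
  have hmem : ((M + 1)⁻¹ * ‖l‖⁻¹) • l ∈ stableSet U A B lam := by
    intro y hy hy0 t ht
    have hn : ‖y 0‖ = (M + 1)⁻¹ := by
      rw [hy0, norm_smul, Real.norm_of_nonneg (by positivity), mul_assoc,
        inv_mul_cancel₀ hl0.ne', mul_one]
    rcases ht.eq_or_lt with rfl | ht
    · rw [hn, mul_zero, Real.exp_zero, one_mul]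
      exact inv_le_one_of_one_le₀ (by linarith)
    · calc Real.exp (lam * t) * ‖y t‖
          ≤ Real.exp (lam * t) * (M * Real.exp (-lam * t) * ‖y 0‖) := by
            gcongr
            exact h y hy t ht
        _ = (Real.exp (lam * t) * Real.exp (-lam * t)) * (M * (M + 1)⁻¹) := by rw [hn]; ring
        _ = M * (M + 1)⁻¹ := by
            rw [← Real.exp_add, neg_mul, add_neg_cancel, Real.exp_zero, one_mul]
        _ ≤ 1 := by
            rw [← div_eq_mul_inv, div_le_one hM1]
            linarith
  have := hl _ hmem
  rw [inner_smul_right, real_inner_self_eq_norm_sq, abs_of_nonneg (by positivity)] at this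
  have h2 : (M + 1)⁻¹ * ‖l‖⁻¹ * ‖l‖ ^ 2 = ‖l‖ / (M + 1) := by
    field_simp
  rw [h2, div_le_one hM1] at this
  exact this

/-- Dual to `IsFlow.smul_exp_mem`: the adjoint moves the map from l onto x. -/
theorem IsFlow.image_stablePolar_subset {U : Set ℝ} (hU : U ⊆ Icc 0 1) {A B : Mat}
    {L : Plane →L[ℝ] Plane} (hL : IsFlow U A B L) {lam τ : ℝ} (hτ : 0 ≤ τ) :
    (Real.exp (lam * τ) • ContinuousLinearMap.adjoint (NormedSpace.exp (τ • L))) ''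
      stablePolar U A B lam ⊆ stablePolar U A B lam := by
  rintro _ ⟨l, hl, rfl⟩ x hx
  have := hl _ (hL.smul_exp_mem hU hτ hx)
  rwa [smul_apply, inner_smul_left, ContinuousLinearMap.adjoint_inner_left, RCLike.conj_to_real,
    ← inner_smul_right]

/-! ### Moment polynomials and existence of a polynomial CLF -/

theorem differentiable_polyFun (p : MvPolynomial (Fin 2) ℝ) : Differentiable ℝ (polyFun p) :=
  fun x => (AnalyticOnNhd.eval_continuousLinearMap'
    (fun i => (EuclideanSpace.proj i : Plane →L[ℝ] ℝ)) p x (mem_univ x)).differentiableAt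

theorem inner_plane (l x : Plane) : inner ℝ l x = l 0 * x 0 + l 1 * x 1 := by
  simp [PiLp.inner_apply, Fin.sum_univ_two, mul_comm]

/-- The polynomial whose value at `x` is the integral of `⟪l, x⟫ ^ n` over `l ∈ K`. -/
noncomputable def momentPoly (K : Set Plane) (n : ℕ) : MvPolynomial (Fin 2) ℝ :=
  ∑ j ∈ Finset.range (n + 1), MvPolynomial.C (∫ l in K, l 0 ^ j * l 1 ^ (n - j) * n.choose j) *
    (MvPolynomial.X 0 ^ j * MvPolynomial.X 1 ^ (n - j))

theorem polyFun_momentPoly {K : Set Plane} (hK : IsCompact K) (n : ℕ) (x : Plane) :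
    polyFun (momentPoly K n) x = ∫ l in K, inner ℝ l x ^ n := by
  have hpow : ∀ l : Plane, inner ℝ l x ^ n = ∑ j ∈ Finset.range (n + 1),
      (l 0 ^ j * l 1 ^ (n - j) * n.choose j) * (x 0 ^ j * x 1 ^ (n - j)) := by
    intro l
    rw [inner_plane, add_pow]
    refine Finset.sum_congr rfl fun j _ => ?_
    rw [mul_pow, mul_pow]
    ring
  simp only [hpow]
  rw [integral_finsetSum]
  · simp only [polyFun, momentPoly, map_sum, map_mul, map_pow, MvPolynomial.eval_C,
      MvPolynomial.eval_X, integral_mul_const]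
  · intro j _
    refine ContinuousOn.integrableOn_compact hK (Continuous.continuousOn ?_)
    fun_prop

theorem continuous_inner_pow (x : Plane) (n : ℕ) :
    Continuous fun l : Plane => (inner ℝ l x : ℝ) ^ n :=
  (continuous_id.inner continuous_const).pow n

/-- The even power is nonnegative and nonzero on an open part of the unit ball, near a small
multiple of x. -/
theorem polyFun_momentPoly_pos {K : Set Plane} (hK : IsCompact K) (hb : Metric.ball 0 1 ⊆ K)
    (k : ℕ) {x : Plane} (hx : x ≠ 0) : 0 < polyFun (momentPoly K (2 * k)) x := by
  rw [polyFun_momentPoly hK, setIntegral_pos_iff_support_of_nonneg_ae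
    (Eventually.of_forall fun l => (even_two_mul k).pow_nonneg _)
    ((continuous_inner_pow x _).continuousOn.integrableOn_compact hK)]
  have hx0 : 0 < ‖x‖ := norm_pos_iff.2 hx
  refine lt_of_lt_of_le (IsOpen.measure_pos (μ := volume)
    (U := {l : Plane | (inner ℝ l x : ℝ) ^ (2 * k) ≠ 0} ∩ Metric.ball 0 1) ?_ ?_)
    (measure_mono (inter_subset_inter_right _ hb))
  · exact (isOpen_ne_fun (continuous_inner_pow x _) continuous_const).inter Metric.isOpen_ball
  · refine ⟨(2 * ‖x‖)⁻¹ • x, pow_ne_zero _ ?_, ?_⟩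
    · rw [inner_smul_left, real_inner_self_eq_norm_sq, RCLike.conj_to_real]
      positivity
    · rw [mem_ball_zero_iff, norm_smul, Real.norm_of_nonneg (by positivity), mul_inv, mul_assoc,
        inv_mul_cancel₀ hx0.ne']
      norm_num

/-- Change of variables, then S(K) ⊆ K. A singular S is separated because injectivity is needed. -/
theorem det_mul_integral_le {K : Set Plane} (hK : IsCompact K) {S : Plane →L[ℝ] Plane}
    (hS : S '' K ⊆ K) {φ : Plane → ℝ} (hφ : Continuous φ) (h0 : ∀ l, 0 ≤ φ l) :
    S.det * ∫ l in K, φ (S l) ≤ ∫ l in K, φ l := by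
  have hpos : 0 ≤ ∫ l in K, φ (S l) := integral_nonneg fun l => h0 _
  rcases eq_or_ne S.det 0 with hd | hd
  · rw [hd, zero_mul]
    exact integral_nonneg h0
  have hinj : Function.Injective S := (S.toContinuousLinearEquivOfDetNeZero hd).injective
  calc S.det * ∫ l in K, φ (S l) ≤ |S.det| * ∫ l in K, φ (S l) :=
        mul_le_mul_of_nonneg_right (le_abs_self _) hpos
    _ = ∫ l in S '' K, φ l := by
        rw [integral_image_eq_integral_abs_det_fderiv_smul volume hK.measurableSet
          (fun l _ => S.hasFDerivWithinAt) hinj.injOn, ← integral_const_mul]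
        rfl
    _ ≤ ∫ l in K, φ l := setIntegral_mono_set (hφ.continuousOn.integrableOn_compact hK)
        (Eventually.of_forall h0) (LE.le.eventuallyLE hS)

/-- The explicit formula serves to differentiate the determinant along a flow. -/
theorem det_smul_adjoint (c : ℝ) (f : Plane →L[ℝ] Plane) :
    (c • ContinuousLinearMap.adjoint f).det =
      c ^ 2 * (f (EuclideanSpace.single 0 1) 0 * f (EuclideanSpace.single 1 1) 1 -
        f (EuclideanSpace.single 0 1) 1 * f (EuclideanSpace.single 1 1) 0) := by
  have hentry : ∀ i j : Fin 2, (ContinuousLinearMap.adjoint f) (EuclideanSpace.single j 1) i =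
      f (EuclideanSpace.single i 1) j := by
    intro i j
    have h := ContinuousLinearMap.adjoint_inner_left f (EuclideanSpace.single i (1 : ℝ))
      (EuclideanSpace.single j (1 : ℝ))
    rw [inner_plane, inner_plane] at h
    fin_cases i <;> fin_cases j <;> simpa using h
  rw [ContinuousLinearMap.det, ← LinearMap.det_toMatrix (EuclideanSpace.basisFun (Fin 2) ℝ).toBasis,
    Matrix.det_fin_two]
  simp only [LinearMap.toMatrix_apply, OrthonormalBasis.coe_toBasis, EuclideanSpace.basisFun_apply,
    ContinuousLinearMap.coe_coe, OrthonormalBasis.coe_toBasis_repr_apply,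
    EuclideanSpace.basisFun_repr, smul_apply, PiLp.smul_apply, hentry, smul_eq_mul]
  ring

theorem nonpos_of_hasDerivAt_of_le {h : ℝ → ℝ} {h' : ℝ} (hd : HasDerivAt h h' 0)
    (hle : ∀ t, 0 < t → h t ≤ h 0) : h' ≤ 0 := by
  have ht := (hasDerivWithinAt_iff_tendsto_slope' (self_notMem_Ioi)).1
    (hd.hasDerivWithinAt (s := Ioi 0))
  refine le_of_tendsto ht ?_
  filter_upwards [self_mem_nhdsWithin] with t ht
  rw [slope_def_field]
  exact div_nonpos_of_nonpos_of_nonneg (sub_nonpos.2 (hle t ht)) (by simpa using ht.le)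

/-- The moment polynomials of `stablePolar` decrease along each flow, at a rate that grows with
the degree. -/
theorem IsFlow.exists_fderiv_momentPoly_le {U : Set ℝ} (hU : U ⊆ Icc 0 1) {A B : Mat}
    {L : Plane →L[ℝ] Plane} (hL : IsFlow U A B L) {lam : ℝ}
    (hK : IsCompact (stablePolar U A B lam)) :
    ∃ c : ℝ, ∀ (k : ℕ) (x : Plane),
      fderiv ℝ (polyFun (momentPoly (stablePolar U A B lam) (2 * k))) x (L x) ≤
        -(c + 2 * k * lam) * polyFun (momentPoly (stablePolar U A B lam) (2 * k)) x := by
  set K := stablePolar U A B lam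
  set S : ℝ → Plane →L[ℝ] Plane := fun τ =>
    Real.exp (lam * τ) • ContinuousLinearMap.adjoint (NormedSpace.exp (τ • L)) with hS
  have hexp : ∀ x τ, DifferentiableAt ℝ (fun τ : ℝ => NormedSpace.exp (τ • L) x) τ :=
    fun x τ => (hasDerivAt_exp_smul_apply L x τ).differentiableAt
  have hdet : DifferentiableAt ℝ (fun τ => (S τ).det) 0 := by
    simp only [hS, det_smul_adjoint]
    have hc : ∀ (i j : Fin 2), DifferentiableAt ℝ
        (fun τ : ℝ => NormedSpace.exp (τ • L) (EuclideanSpace.single i 1) j) 0 := fun i j =>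
      (EuclideanSpace.proj j : Plane →L[ℝ] ℝ).differentiableAt.comp (0 : ℝ) (hexp _ 0)
    have he : DifferentiableAt ℝ (fun τ : ℝ => Real.exp (lam * τ)) 0 := by fun_prop
    exact (he.pow 2).mul (((hc 0 0).mul (hc 1 1)).sub ((hc 0 1).mul (hc 1 0)))
  have hdet0 : (S 0).det = 1 := by
    simp only [hS, det_smul_adjoint, exp_zero_smul_apply]
    simp
  refine ⟨deriv (fun τ => (S τ).det) 0, fun k x => ?_⟩
  set V := polyFun (momentPoly K (2 * k)) with hV
  have hVd : HasDerivAt (fun τ : ℝ => V (NormedSpace.exp (τ • L) x)) (fderiv ℝ V x (L x)) 0 := by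
    have h1 := hasDerivAt_exp_smul_apply L x 0
    have h2 := (differentiable_polyFun (momentPoly K (2 * k))
      (NormedSpace.exp ((0 : ℝ) • L) x)).hasFDerivAt.comp_hasDerivAt (0 : ℝ) h1
    rwa [exp_zero_smul_apply] at h2
  have hed : HasDerivAt (fun τ => Real.exp (2 * k * lam * τ)) (2 * k * lam) 0 := by
    simpa using ((hasDerivAt_id (0 : ℝ)).const_mul (2 * k * lam)).exp
  have hd := (hdet.hasDerivAt.mul hed).mul hVd
  have hle := nonpos_of_hasDerivAt_of_le hd fun τ hτ => by
    have h := det_mul_integral_le hK (hL.image_stablePolar_subset hU hτ.le)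
      (continuous_inner_pow x (2 * k)) (fun l => (even_two_mul k).pow_nonneg _)
    have hint : ∫ l in K, (inner ℝ (S τ l) x : ℝ) ^ (2 * k) =
        Real.exp (2 * k * lam * τ) * V (NormedSpace.exp (τ • L) x) := by
      rw [hV, polyFun_momentPoly hK, ← integral_const_mul]
      refine integral_congr_ae (Eventually.of_forall fun l => ?_)
      simp only [hS]
      rw [smul_apply, inner_smul_left, ContinuousLinearMap.adjoint_inner_left,
        RCLike.conj_to_real, mul_pow, ← Real.exp_nat_mul]
      congr 2
      push_cast
      ring
    have hx : ∫ l in K, (inner ℝ l x : ℝ) ^ (2 * k) = V x := by rw [hV, polyFun_momentPoly hK]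
    simp only [Pi.mul_apply, hdet0, exp_zero_smul_apply, mul_zero, Real.exp_zero, one_mul]
    rw [mul_assoc, ← hint, ← hx]
    exact h
  simp only [Pi.mul_apply, hdet0, exp_zero_smul_apply, mul_zero, Real.exp_zero, one_mul,
    mul_one] at hle
  linarith

/-- The constants a and b do not depend on k, so 2k lam > 1 + |a| + |b| yields decay rate 1 along
both fields. -/
theorem exists_polynomial_isCLF {U : Set ℝ} (hU : U ⊆ Icc 0 1) (h0 : (0 : ℝ) ∈ U)
    (h1 : (1 : ℝ) ∈ U) {A B : Mat} (h : IsGUES U A B) :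
    ∃ p : MvPolynomial (Fin 2) ℝ, IsCLF U A B (polyFun p) := by
  obtain ⟨M, lam, hM, hlam, hgues⟩ := h
  have hK := isCompact_stablePolar hM hgues
  obtain ⟨a, ha⟩ := (isFlow_left h1 A B).exists_fderiv_momentPoly_le hU hK
  obtain ⟨b, hb⟩ := (isFlow_right h0 A B).exists_fderiv_momentPoly_le hU hK
  obtain ⟨k, hk⟩ := exists_nat_gt ((1 + |a| + |b|) / (2 * lam))
  rw [div_lt_iff₀ (by positivity)] at hk
  have hk0 : k ≠ 0 := by
    rintro rfl
    have := abs_nonneg a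
    have := abs_nonneg b
    simp at hk
    linarith
  set V := polyFun (momentPoly (stablePolar U A B lam) (2 * k)) with hV
  have hball := ball_subset_stablePolar (isFlow_left h1 A B) lam
  have hV0 : V 0 = 0 := by
    simp [hV, polyFun_momentPoly hK, hk0]
  have hpos : ∀ y, y ≠ 0 → 0 < V y := fun y hy => polyFun_momentPoly_pos hK hball k hy
  have hnn : ∀ y, 0 ≤ V y := by
    intro y
    rcases eq_or_ne y 0 with rfl | hy
    · exact hV0.ge
    · exact (hpos y hy).le
  refine ⟨_, isCLF_of_fderiv_le hU one_pos (differentiable_polyFun _) hV0 hpos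
    (fun y => (ha k y).trans (mul_le_mul_of_nonneg_right ?_ (hnn y)))
    (fun y => (hb k y).trans (mul_le_mul_of_nonneg_right ?_ (hnn y)))⟩
  · linarith [neg_abs_le a, abs_nonneg b]
  · linarith [neg_abs_le b, abs_nonneg a]

/-! ### Rigidity of the undamped pair -/

/-- A polynomial that vanishes at the origin and does not increase along the two flows that contract
horizontal lines to the diagonal and vertical lines to the antidiagonal is zero. -/
theorem eq_zero_of_contraction_le {p : MvPolynomial (Fin 2) ℝ} (h0 : MvPolynomial.eval 0 p = 0)
    (hA : ∀ a b t : ℝ, 0 ≤ t → MvPolynomial.eval ![b + (a - b) * Real.exp (-t), b] p ≤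
      MvPolynomial.eval ![a, b] p)
    (hB : ∀ a b t : ℝ, 0 ≤ t → MvPolynomial.eval ![a, -a + (b + a) * Real.exp (-t)] p ≤
      MvPolynomial.eval ![a, b] p) : p = 0 := by
  set g : ℝ → ℝ → ℝ := fun a b => MvPolynomial.eval ![a, b] p with hg
  have hlim : ∀ f : ℝ → ℝ, Continuous f → ∀ r : ℝ, (∀ t, 0 ≤ t → f (Real.exp (-t)) ≤ r) →
      f 0 ≤ r := fun f hf r h =>
    le_of_tendsto ((hf.tendsto 0).comp (Real.tendsto_exp_neg_atTop_nhds_zero))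
      ((eventually_ge_atTop 0).mono h)
  have hA0 : ∀ a b, g b b ≤ g a b := by
    intro a b
    have := hlim (fun X => g (b + (a - b) * X) b)
      ((MvPolynomial.continuous_eval p).comp (by fun_prop)) _ (hA a b)
    simpa using this
  have hB0 : ∀ a b, g a (-a) ≤ g a b := by
    intro a b
    have := hlim (fun X => g a (-a + (b + a) * X))
      ((MvPolynomial.continuous_eval p).comp (by fun_prop)) _ (hB a b)
    simpa using this
  -- The values do not increase around (s,s) → (s,-s) → (-s,-s) → (-s,s) → (s,s), hence are equal at
  -- all four vertices.
  have hcycle : ∀ s, g s (-s) = g s s ∧ g (-s) s = g s s := by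
    intro s
    have h1 := hB0 s s
    have h2 := hA0 s (-s)
    have h3 := hB0 (-s) (-s)
    rw [neg_neg] at h3
    have h4 := hA0 (-s) s
    constructor <;> linarith
  -- For t ≥ 0 the argument takes infinitely many values, so constancy along a side extends to its
  -- whole line.
  have hext : ∀ q : Polynomial ℝ, ∀ r s : ℝ, s ≠ 0 →
      (∀ t, 0 ≤ t → q.eval (-s + 2 * s * Real.exp (-t)) = r) → ∀ y, q.eval y = r := by
    intro q r s hs h y
    have : q = Polynomial.C r := by
      refine Polynomial.eq_of_infinite_eval_eq _ _ (Set.infinite_of_injOn_mapsTo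
        (f := fun t => -s + 2 * s * Real.exp (-t)) (s := Ici (0 : ℝ)) ?_ ?_ (Ici_infinite 0))
      · intro t _ t' _ htt
        have h2 : 2 * s ≠ 0 := by positivity
        simpa [h2] using htt
      · intro t ht
        simp [h t ht]
    rw [this, Polynomial.eval_C]
  have hvert : ∀ s, s ≠ 0 → ∀ y, g s y = g s s := by
    intro s hs
    have heval : ∀ y, (MvPolynomial.aeval ![Polynomial.C s, Polynomial.X] p).eval y = g s y := by
      intro y
      rw [← Polynomial.coe_evalRingHom, MvPolynomial.aeval_def, MvPolynomial.hom_eval₂, hg]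
      simp only [MvPolynomial.eval, MvPolynomial.coe_eval₂Hom]
      congr 1
      · ext; simp
      · ext i; fin_cases i <;> simp
    intro y
    rw [← heval]
    refine hext _ _ s hs (fun t ht => ?_) y
    rw [heval]
    -- On the side the value lies between those at its start and its limit, which agree.
    refine le_antisymm ?_ ((hcycle s).1 ▸ hB0 s _)
    have := hB s s t ht
    rwa [← two_mul] at this
  have hhor : ∀ s, s ≠ 0 → ∀ x, g x s = g s s := by
    intro s hs
    have heval : ∀ y, (MvPolynomial.aeval ![Polynomial.X, Polynomial.C s] p).eval y = g y s := by
      intro y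
      rw [← Polynomial.coe_evalRingHom, MvPolynomial.aeval_def, MvPolynomial.hom_eval₂, hg]
      simp only [MvPolynomial.eval, MvPolynomial.coe_eval₂Hom]
      congr 1
      · ext; simp
      · ext i; fin_cases i <;> simp
    intro x
    rw [← heval]
    refine hext _ _ (-s) (neg_ne_zero.2 hs) (fun t ht => ?_) x
    rw [heval]
    refine le_antisymm ?_ (hA0 _ s)
    have := hA (-s) s t ht
    rw [show MvPolynomial.eval ![-s, s] p = g s s from (hcycle s).2] at this
    rwa [show s + (-s - s) * Real.exp (-t) = - -s + 2 * -s * Real.exp (-t) by ring] at this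
  -- The line argument works only off the axes; the factor X₀X₁ makes the identity global and is
  -- then cancelled.
  have hprod : (p - MvPolynomial.C (g 1 1)) * (MvPolynomial.X 0 * MvPolynomial.X 1) = 0 := by
    refine MvPolynomial.funext fun x => ?_
    have hx : x = ![x 0, x 1] := by ext i; fin_cases i <;> rfl
    simp only [map_mul, map_sub, MvPolynomial.eval_C, MvPolynomial.eval_X, map_zero]
    rcases eq_or_ne (x 0) 0 with h | h
    · simp [h]
    rcases eq_or_ne (x 1) 0 with h' | h'
    · simp [h']
    have : MvPolynomial.eval x p = g 1 1 := by
      rw [hx]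
      change g (x 0) (x 1) = g 1 1
      rw [hvert _ h, ← hvert _ h 1, hhor 1 one_ne_zero]
    rw [this, sub_self, zero_mul]
  have hp : p = MvPolynomial.C (g 1 1) := by
    rw [mul_eq_zero, sub_eq_zero] at hprod
    exact hprod.resolve_right (mul_ne_zero (MvPolynomial.X_ne_zero 0) (MvPolynomial.X_ne_zero 1))
  rw [hp, MvPolynomial.eval_C] at h0
  rw [hp, h0, map_zero]

/-! ### Bounded-degree polynomials as coefficient vectors -/

/-- The polynomial in two variables with given coefficients at the exponents below `s`. -/
noncomputable def ofCoeffs (s : Fin 2 →₀ ℕ) (c : Finset.Iic s → ℝ) : MvPolynomial (Fin 2) ℝ :=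
  ∑ d : Finset.Iic s, MvPolynomial.monomial d.1 (c d)

theorem eval_ofCoeffs (s : Fin 2 →₀ ℕ) (c : Finset.Iic s → ℝ) (x : Fin 2 → ℝ) :
    MvPolynomial.eval x (ofCoeffs s c) = ∑ d : Finset.Iic s, c d * ∏ i, x i ^ d.1 i := by
  simp [ofCoeffs, MvPolynomial.eval_monomial, Finsupp.prod_fintype]

theorem continuous_eval_ofCoeffs (s : Fin 2 →₀ ℕ) :
    Continuous fun z : (Finset.Iic s → ℝ) × (Fin 2 → ℝ) =>
      MvPolynomial.eval z.2 (ofCoeffs s z.1) := by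
  simp only [eval_ofCoeffs]
  fun_prop

theorem eq_zero_of_ofCoeffs_eq_zero {s : Fin 2 →₀ ℕ} {c : Finset.Iic s → ℝ}
    (h : ofCoeffs s c = 0) : c = 0 := by
  ext d
  have := congrArg (MvPolynomial.coeff d.1) h
  rw [ofCoeffs, MvPolynomial.coeff_sum, Finset.sum_eq_single d, MvPolynomial.coeff_monomial,
    if_pos rfl] at this
  · simpa using this
  · intro e _ hed
    rw [MvPolynomial.coeff_monomial, if_neg fun h' => hed (Subtype.ext h')]
  · simp

theorem ofCoeffs_smul (s : Fin 2 →₀ ℕ) (r : ℝ) (c : Finset.Iic s → ℝ) :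
    ofCoeffs s (r • c) = r • ofCoeffs s c := by
  simp [ofCoeffs, Finset.smul_sum, MvPolynomial.smul_monomial]

/-- The box of exponents up to (m, m) is larger than needed; only its finiteness matters. -/
theorem exists_eq_ofCoeffs {p : MvPolynomial (Fin 2) ℝ} {m : ℕ} (hp : p.totalDegree ≤ m) :
    ∃ c, p = ofCoeffs (Finsupp.equivFunOnFinite.symm fun _ => m) c := by
  refine ⟨fun d => p.coeff d.1, ?_⟩
  rw [ofCoeffs, Finset.sum_coe_sort (Finset.Iic _)
    (fun d : Fin 2 →₀ ℕ => MvPolynomial.monomial d (p.coeff d))]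
  conv_lhs => rw [p.as_sum]
  refine Finset.sum_subset ?_ ?_
  · intro d hd
    rw [Finset.mem_Iic]
    intro i
    have h1 := (MvPolynomial.le_totalDegree hd).trans hp
    rw [Finsupp.sum_fintype _ _ (fun _ => rfl)] at h1
    exact (Finset.single_le_sum (f := fun i => d i) (fun _ _ => Nat.zero_le _)
      (Finset.mem_univ i)).trans h1
  · intro d _ hd
    rw [MvPolynomial.notMem_support_iff.1 hd, map_zero]

/-! ### The damped pair is Hurwitz and GUES -/

/-- The contraction of horizontal lines to the diagonal, with an additional damping `e`. -/
def horizontalMat (e : ℝ) : Mat := !![-1 - e, 1; 0, -e]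

/-- The contraction of vertical lines to the antidiagonal, with an additional damping `e`. -/
def verticalMat (e : ℝ) : Mat := !![-e, 0; -1, -1 - e]

theorem planeMap_horizontalMat (e : ℝ) (x : Plane) :
    planeMap (horizontalMat e) x 0 = (-1 - e) * x 0 + x 1 ∧
      planeMap (horizontalMat e) x 1 = -e * x 1 := by
  constructor <;>
  simp [horizontalMat, Matrix.ofLp_toEuclideanCLM, Matrix.mulVec, dotProduct, Fin.sum_univ_two]

theorem planeMap_verticalMat (e : ℝ) (x : Plane) :
    planeMap (verticalMat e) x 0 = -e * x 0 ∧
      planeMap (verticalMat e) x 1 = -x 0 + (-1 - e) * x 1 := by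
  constructor <;>
  simp [verticalMat, Matrix.ofLp_toEuclideanCLM, Matrix.mulVec, dotProduct, Fin.sum_univ_two]

theorem isHurwitz_of_triangular {A : Mat} (h : A 0 1 * A 1 0 = 0) (h0 : A 0 0 < 0)
    (h1 : A 1 1 < 0) : IsHurwitz A := by
  intro z hz
  rw [spectrum.mem_iff, Matrix.isUnit_iff_isUnit_det, isUnit_iff_ne_zero, not_not,
    Matrix.det_fin_two] at hz
  have h' : (A 0 1 : ℂ) * A 1 0 = 0 := by exact_mod_cast h
  simp only [Matrix.sub_apply, Matrix.algebraMap_matrix_apply, Matrix.map_apply, if_true,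
    Algebra.algebraMap_self, RingHom.id_apply, zero_ne_one, one_ne_zero, if_false, zero_sub,
    neg_mul_neg, h', sub_zero, mul_eq_zero, sub_eq_zero] at hz
  rcases hz with rfl | rfl
  · simpa using h0
  · simpa using h1

theorem isHurwitz_horizontalMat {e : ℝ} (he : 0 < e) : IsHurwitz (horizontalMat e) :=
  isHurwitz_of_triangular (by simp [horizontalMat]) (by simp [horizontalMat]; linarith)
    (by simpa [horizontalMat])

theorem isHurwitz_verticalMat {e : ℝ} (he : 0 < e) : IsHurwitz (verticalMat e) :=
  isHurwitz_of_triangular (by simp [verticalMat]) (by simpa [verticalMat])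
    (by simp [verticalMat]; linarith)

/-- Young's inequality, from Bernoulli's inequality for (b / a) ^ n; evenness reduces it to
nonnegative a, b. -/
theorem nat_mul_pow_mul_le {n : ℕ} (hn : Even n) (hn0 : n ≠ 0) (a b : ℝ) :
    n * (a ^ (n - 1) * b) ≤ (n - 1) * a ^ n + b ^ n := by
  have hpos : ∀ a b : ℝ, 0 ≤ a → 0 ≤ b → n * (a ^ (n - 1) * b) ≤ (n - 1) * a ^ n + b ^ n := by
    intro a b ha hb
    rcases ha.eq_or_lt with rfl | ha
    · have h2 : n - 1 ≠ 0 := by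
        rintro h
        obtain rfl : n = 1 := by omega
        exact absurd hn (by decide)
      rw [zero_pow h2, zero_pow hn0]
      simpa using pow_nonneg hb n
    · have h := one_add_mul_le_pow (a := b / a - 1) (by linarith [div_nonneg hb ha.le]) n
      rw [add_sub_cancel, div_pow, le_div_iff₀ (pow_pos ha n)] at h
      have h3 : a ^ n = a ^ (n - 1) * a := by rw [← pow_succ, Nat.sub_add_cancel (by omega)]
      have h4 : (1 + n * (b / a - 1)) * a ^ n = n * (a ^ (n - 1) * b) - (n - 1) * a ^ n := by
        rw [h3]
        field_simp
        ring
      linarith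
  refine le_trans ?_ ((hpos |a| |b| (abs_nonneg _) (abs_nonneg _)).trans_eq ?_)
  · refine mul_le_mul_of_nonneg_left ?_ (Nat.cast_nonneg n)
    rw [← abs_pow, ← abs_mul]
    exact le_abs_self _
  · rw [hn.pow_abs, hn.pow_abs]

theorem hasFDerivAt_coord_pow (n : ℕ) (x : Plane) :
    HasFDerivAt (fun x : Plane => x 0 ^ n + x 1 ^ n)
      ((n * x 0 ^ (n - 1)) • (EuclideanSpace.proj 0 : Plane →L[ℝ] ℝ) +
        (n * x 1 ^ (n - 1)) • (EuclideanSpace.proj 1 : Plane →L[ℝ] ℝ)) x := by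
  have h : ∀ i : Fin 2, HasFDerivAt (fun x : Plane => x i ^ n)
      ((n * x i ^ (n - 1)) • (EuclideanSpace.proj i : Plane →L[ℝ] ℝ)) x := fun i => by
    simpa using (EuclideanSpace.proj i : Plane →L[ℝ] ℝ).hasFDerivAt (x := x) |>.pow n
  exact (h 0).add (h 1)

theorem coord_pow_le_norm_pow {n : ℕ} (hn : Even n) (hn0 : n ≠ 0) (x : Plane) :
    x 0 ^ n + x 1 ^ n ≤ (2 * ‖x‖) ^ n := by
  have h : ∀ i, x i ^ n ≤ ‖x‖ ^ n := fun i => by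
    rw [← hn.pow_abs]
    exact pow_le_pow_left₀ (abs_nonneg _) (PiLp.norm_apply_le x i) n
  have h2 : (2 : ℝ) ≤ 2 ^ n := le_self_pow₀ one_le_two hn0
  rw [mul_pow]
  nlinarith [h 0, h 1, pow_nonneg (norm_nonneg x) n]

theorem norm_pow_le_coord_pow {n : ℕ} (hn : Even n) (x : Plane) :
    ‖x‖ ^ n ≤ 2 ^ n * (x 0 ^ n + x 1 ^ n) := by
  have hle : ‖x‖ ≤ 2 * max |x 0| |x 1| := by
    have h1 : ‖x‖ ≤ |x 0| + |x 1| := by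
      rw [EuclideanSpace.norm_eq, Fin.sum_univ_two, Real.norm_eq_abs, Real.norm_eq_abs]
      refine Real.sqrt_le_iff.2 ⟨by positivity, ?_⟩
      nlinarith [mul_nonneg (abs_nonneg (x 0)) (abs_nonneg (x 1))]
    linarith [le_max_left |x 0| |x 1|, le_max_right |x 0| |x 1|]
  refine (pow_le_pow_left₀ (norm_nonneg _) hle n).trans ?_
  rw [mul_pow]
  refine mul_le_mul_of_nonneg_left ?_ (by positivity)
  have h0 := hn.pow_nonneg (x 0)
  have h1 := hn.pow_nonneg (x 1)
  rcases max_choice |x 0| |x 1| with h | h <;> rw [h, hn.pow_abs] <;> linarith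

/-- Young's inequality bounds the cross term, so x₀ⁿ + x₁ⁿ decays at rate ne - 1 along both fields.
The exponent n must grow as e → 0. -/
theorem isGUES_horizontalMat_verticalMat {U : Set ℝ} (hU : U ⊆ Icc 0 1) {e : ℝ} (he : 0 < e) :
    IsGUES U (horizontalMat e) (verticalMat e) := by
  obtain ⟨k, hk⟩ := exists_nat_gt (1 / (2 * e))
  rw [div_lt_iff₀ (by positivity)] at hk
  have hk0 : k ≠ 0 := by
    rintro rfl
    simp at hk
    linarith
  set n := 2 * k with hn
  have hne : Even n := even_two_mul k
  have hn0 : n ≠ 0 := by omega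
  have hnR : (0 : ℝ) < n := by positivity
  set c : ℝ := n * e - 1 with hc
  have hc0 : 0 < c := by
    rw [hc, hn]
    push_cast
    linarith
  have hsucc : ∀ a : ℝ, a ^ (n - 1) * a = a ^ n := fun a => by
    rw [← pow_succ, Nat.sub_add_cancel (by omega)]
  -- The two comparisons with ‖x‖ ^ n cost a factor 2 each, and the n-th root divides the rate by n.
  refine ⟨4, c / n, by norm_num, by positivity, ?_⟩
  rintro x ⟨u, hu, hx⟩ t ht
  have hu' : IsSwitching (Icc 0 1) u := ⟨hu.1, fun t ht => hU (hu.2 t ht)⟩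
  have hV := hx.le_exp_mul hu' (Q := fun x : Plane => x 0 ^ n + x 1 ^ n) (K := -c)
    (fun y => (hasFDerivAt_coord_pow n y).differentiableAt) ?_ ?_ le_rfl ht.le
  · have h1 := norm_pow_le_coord_pow hne (x t)
    have h2 := coord_pow_le_norm_pow hne hn0 (x 0)
    have h3 : ‖x t‖ ^ n ≤ (4 * Real.exp (-(c / n) * t) * ‖x 0‖) ^ n := by
      have hexp : Real.exp (-(c / n) * t) ^ n = Real.exp (-c * (t - 0)) := by
        rw [← Real.exp_nat_mul]
        congr 1
        field_simp
        ring
      calc ‖x t‖ ^ n ≤ 2 ^ n * ((2 * ‖x 0‖) ^ n * Real.exp (-c * (t - 0))) := by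
            refine h1.trans (mul_le_mul_of_nonneg_left (hV.trans ?_) (by positivity))
            exact mul_le_mul_of_nonneg_right h2 (Real.exp_pos _).le
        _ = (4 * Real.exp (-(c / n) * t) * ‖x 0‖) ^ n := by
            rw [← hexp, ← mul_pow, ← mul_pow]
            congr 1
            ring
    exact le_of_pow_le_pow_left₀ hn0 (by positivity) h3
  · intro y
    obtain ⟨ha, hb⟩ := planeMap_horizontalMat e y
    rw [(hasFDerivAt_coord_pow n y).fderiv]
    simp only [add_apply, smul_apply, PiLp.proj_apply, ha, hb, smul_eq_mul]
    have h := nat_mul_pow_mul_le hne hn0 (y 0) (y 1)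
    have h' : n * y 0 ^ (n - 1) * ((-1 - e) * y 0 + y 1) + n * y 1 ^ (n - 1) * (-e * y 1) =
        -(n * (1 + e)) * y 0 ^ n + n * (y 0 ^ (n - 1) * y 1) - n * e * y 1 ^ n := by
      rw [← hsucc (y 0), ← hsucc (y 1)]
      ring
    rw [h', hc]
    linarith [hne.pow_nonneg (y 0)]
  · intro y
    obtain ⟨ha, hb⟩ := planeMap_verticalMat e y
    rw [(hasFDerivAt_coord_pow n y).fderiv]
    simp only [add_apply, smul_apply, PiLp.proj_apply, ha, hb, smul_eq_mul]
    have h := nat_mul_pow_mul_le hne hn0 (y 1) (-y 0)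
    rw [hne.neg_pow] at h
    have h' : n * y 0 ^ (n - 1) * (-e * y 0) + n * y 1 ^ (n - 1) * (-y 0 + (-1 - e) * y 1) =
        -(n * (1 + e)) * y 1 ^ n + n * (y 1 ^ (n - 1) * -y 0) - n * e * y 0 ^ n := by
      rw [← hsucc (y 0), ← hsucc (y 1)]
      ring
    rw [h', hc]
    linarith [hne.pow_nonneg (y 1)]

/-! ### Explicit trajectories of the damped pair -/

theorem hasDerivAt_plane {f g : ℝ → ℝ} {v : Plane} {t : ℝ} (hf : HasDerivAt f (v 0) t)
    (hg : HasDerivAt g (v 1) t) : HasDerivAt (fun s => (!₂[f s, g s] : Plane)) v t := by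
  have h : HasDerivAt (fun s => ![f s, g s]) v.ofLp t := by
    rw [hasDerivAt_pi]
    intro i
    fin_cases i
    · exact hf
    · exact hg
  exact (PiLp.continuousLinearEquiv 2 ℝ fun _ : Fin 2 => ℝ).symm.hasFDerivAt.comp_hasDerivAt t h

theorem isTrajectory_horizontal {U : Set ℝ} (h1 : (1 : ℝ) ∈ U) (e a b : ℝ) (B : Mat) :
    IsTrajectory U (horizontalMat e) B fun t =>
      !₂[Real.exp (-e * t) * (b + (a - b) * Real.exp (-t)), Real.exp (-e * t) * b] := by
  refine ⟨fun _ => 1, isSwitching_const h1, isSolution_of_hasDerivAt fun t => ?_⟩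
  have he : HasDerivAt (fun t => Real.exp (-e * t)) (Real.exp (-e * t) * -e) t := by
    simpa using ((hasDerivAt_id t).const_mul (-e)).exp
  have h' : HasDerivAt (fun t => Real.exp (-t)) (-Real.exp (-t)) t := by
    simpa using (hasDerivAt_id t).neg.exp
  rw [one_smul, sub_self, zero_smul, add_zero]
  refine hasDerivAt_plane ?_ ?_
  · refine (he.mul ((h'.const_mul (a - b)).const_add b)).congr_deriv ?_
    rw [(planeMap_horizontalMat e _).1]
    simp
    ring
  · refine (he.mul_const b).congr_deriv ?_
    rw [(planeMap_horizontalMat e _).2]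
    simp
    ring

theorem isTrajectory_vertical {U : Set ℝ} (h0 : (0 : ℝ) ∈ U) (e a b : ℝ) (A : Mat) :
    IsTrajectory U A (verticalMat e) fun t =>
      !₂[Real.exp (-e * t) * a, Real.exp (-e * t) * (-a + (b + a) * Real.exp (-t))] := by
  refine ⟨fun _ => 0, isSwitching_const h0, isSolution_of_hasDerivAt fun t => ?_⟩
  have he : HasDerivAt (fun t => Real.exp (-e * t)) (Real.exp (-e * t) * -e) t := by
    simpa using ((hasDerivAt_id t).const_mul (-e)).exp
  have h' : HasDerivAt (fun t => Real.exp (-t)) (-Real.exp (-t)) t := by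
    simpa using (hasDerivAt_id t).neg.exp
  rw [zero_smul, sub_zero, one_smul, zero_add]
  refine hasDerivAt_plane ?_ ?_
  · refine (he.mul_const a).congr_deriv ?_
    rw [(planeMap_verticalMat e _).1]
    simp
    ring
  · refine (he.mul ((h'.const_mul (b + a)).const_add (-a))).congr_deriv ?_
    rw [(planeMap_verticalMat e _).2]
    simp
    ring

/-- Only the weak inequality is retained, since it survives the limit e → 0. -/
theorem IsCLF.le_of_isTrajectory {U : Set ℝ} {A B : Mat} {V : Plane → ℝ} (hV : IsCLF U A B V)
    {x : ℝ → Plane} (hx : IsTrajectory U A B x) {t : ℝ} (ht : 0 ≤ t) : V (x t) ≤ V (x 0) := by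
  by_cases hc : ∃ c : Plane, ∀ t, 0 ≤ t → x t = c
  · obtain ⟨c, hc⟩ := hc
    rw [hc t ht, hc 0 le_rfl]
  · exact (hV.2.2.2 x hx hc).antitoneOn self_mem_Ici ht ht

theorem polyFun_mk (p : MvPolynomial (Fin 2) ℝ) (a b : ℝ) :
    polyFun p !₂[a, b] = MvPolynomial.eval ![a, b] p := rfl

theorem IsCLF.eval_horizontal_le {U : Set ℝ} (h1 : (1 : ℝ) ∈ U) {e : ℝ} {B : Mat}
    {p : MvPolynomial (Fin 2) ℝ} (hp : IsCLF U (horizontalMat e) B (polyFun p)) (a b : ℝ) {t : ℝ}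
    (ht : 0 ≤ t) :
    MvPolynomial.eval ![Real.exp (-e * t) * (b + (a - b) * Real.exp (-t)), Real.exp (-e * t) * b] p
      ≤ MvPolynomial.eval ![a, b] p := by
  simpa [polyFun_mk] using hp.le_of_isTrajectory (isTrajectory_horizontal h1 e a b B) ht

theorem IsCLF.eval_vertical_le {U : Set ℝ} (h0 : (0 : ℝ) ∈ U) {e : ℝ} {A : Mat}
    {p : MvPolynomial (Fin 2) ℝ} (hp : IsCLF U A (verticalMat e) (polyFun p)) (a b : ℝ) {t : ℝ}
    (ht : 0 ≤ t) :
    MvPolynomial.eval ![Real.exp (-e * t) * a, Real.exp (-e * t) * (-a + (b + a) * Real.exp (-t))] p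
      ≤ MvPolynomial.eval ![a, b] p := by
  simpa [polyFun_mk] using hp.le_of_isTrajectory (isTrajectory_vertical h0 e a b A) ht

/-! ### Compactness as the damping vanishes -/

/-- A polynomial with coefficients on the unit sphere that vanishes at the origin and does not
increase along the two flows with damping `e`. -/
def IsNormalizedLyapunov (s : Fin 2 →₀ ℕ) (e : ℝ) (c : Finset.Iic s → ℝ) : Prop :=
  ‖c‖ = 1 ∧ MvPolynomial.eval 0 (ofCoeffs s c) = 0 ∧
    (∀ a b t : ℝ, 0 ≤ t → MvPolynomial.eval
      ![Real.exp (-e * t) * (b + (a - b) * Real.exp (-t)), Real.exp (-e * t) * b]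
        (ofCoeffs s c) ≤ MvPolynomial.eval ![a, b] (ofCoeffs s c)) ∧
    ∀ a b t : ℝ, 0 ≤ t → MvPolynomial.eval
      ![Real.exp (-e * t) * a, Real.exp (-e * t) * (-a + (b + a) * Real.exp (-t))]
        (ofCoeffs s c) ≤ MvPolynomial.eval ![a, b] (ofCoeffs s c)

/-- Positivity excludes c = 0, and the retained conditions are invariant under positive scaling. -/
theorem IsCLF.exists_isNormalizedLyapunov {U : Set ℝ} (h0 : (0 : ℝ) ∈ U) (h1 : (1 : ℝ) ∈ U)
    {e : ℝ} {s : Fin 2 →₀ ℕ} {c : Finset.Iic s → ℝ}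
    (hp : IsCLF U (horizontalMat e) (verticalMat e) (polyFun (ofCoeffs s c))) :
    ∃ c, IsNormalizedLyapunov s e c := by
  have hc : c ≠ 0 := by
    rintro rfl
    have h := hp.2.2.1 !₂[1, 1] (fun h => by simpa using congrArg (fun x : Plane => x 0) h)
    rw [polyFun, eval_ofCoeffs] at h
    simp at h
  have hc0 : 0 < ‖c‖ := norm_pos_iff.2 hc
  refine ⟨‖c‖⁻¹ • c, ?_, ?_, fun a b t ht => ?_, fun a b t ht => ?_⟩
  · rw [norm_smul, norm_inv, norm_norm, inv_mul_cancel₀ hc0.ne']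
  · have : MvPolynomial.eval 0 (ofCoeffs s c) = 0 := hp.2.1
    rw [ofCoeffs_smul, MvPolynomial.smul_eval, this, mul_zero]
  · rw [ofCoeffs_smul, MvPolynomial.smul_eval, MvPolynomial.smul_eval]
    exact mul_le_mul_of_nonneg_left (hp.eval_horizontal_le h1 a b ht) (inv_nonneg.2 hc0.le)
  · rw [ofCoeffs_smul, MvPolynomial.smul_eval, MvPolynomial.smul_eval]
    exact mul_le_mul_of_nonneg_left (hp.eval_vertical_le h0 a b ht) (inv_nonneg.2 hc0.le)

theorem not_isNormalizedLyapunov_zero (s : Fin 2 →₀ ℕ) (c : Finset.Iic s → ℝ) :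
    ¬ IsNormalizedLyapunov s 0 c := by
  rintro ⟨hc, hc0, hcA, hcB⟩
  have hzero : ofCoeffs s c = 0 := by
    refine eq_zero_of_contraction_le hc0 (fun a b t ht => ?_) (fun a b t ht => ?_)
    · simpa only [neg_zero, zero_mul, Real.exp_zero, one_mul] using hcA a b t ht
    · simpa only [neg_zero, zero_mul, Real.exp_zero, one_mul] using hcB a b t ht
  rw [eq_zero_of_ofCoeffs_eq_zero hzero, norm_zero] at hc
  exact zero_ne_one hc

/-- The unit sphere of coefficients is compact, and every condition is closed jointly in e and c. -/
theorem exists_isNormalizedLyapunov_of_tendsto {s : Fin 2 →₀ ℕ} {e : ℕ → ℝ} {r : ℝ}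
    (he : Tendsto e atTop (𝓝 r)) (h : ∀ n, ∃ c, IsNormalizedLyapunov s (e n) c) :
    ∃ c, IsNormalizedLyapunov s r c := by
  choose c hc hc0 hcA hcB using h
  obtain ⟨c', hc', φ, hφ, hlim⟩ := (isCompact_sphere (0 : Finset.Iic s → ℝ) 1).tendsto_subseq
    (x := c) fun n => mem_sphere_zero_iff_norm.2 (hc n)
  have heval : ∀ f : ℝ → Fin 2 → ℝ, Continuous f →
      Tendsto (fun n => MvPolynomial.eval (f (e (φ n))) (ofCoeffs s (c (φ n)))) atTop
        (𝓝 (MvPolynomial.eval (f r) (ofCoeffs s c'))) := by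
    intro f hf
    have hpair : Tendsto (fun n => (c (φ n), f (e (φ n)))) atTop (𝓝 (c', f r)) :=
      hlim.prodMk_nhds ((hf.tendsto r).comp (he.comp hφ.tendsto_atTop))
    obtain ⟨F, hF, hFc⟩ : ∃ F : (Finset.Iic s → ℝ) × (Fin 2 → ℝ) → ℝ,
        (∀ c x, MvPolynomial.eval x (ofCoeffs s c) = F (c, x)) ∧ Continuous F :=
      ⟨_, fun _ _ => rfl, continuous_eval_ofCoeffs s⟩
    simp only [hF]
    exact (hFc.tendsto (c', f r)).comp hpair
  have hle : ∀ (f : ℝ → Fin 2 → ℝ) (y : Fin 2 → ℝ), Continuous f →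
      (∀ n, MvPolynomial.eval (f (e n)) (ofCoeffs s (c n)) ≤
        MvPolynomial.eval y (ofCoeffs s (c n))) →
      MvPolynomial.eval (f r) (ofCoeffs s c') ≤ MvPolynomial.eval y (ofCoeffs s c') :=
    fun f y hf h => le_of_tendsto_of_tendsto' (heval f hf)
      (heval (fun _ => y) continuous_const) fun n => h (φ n)
  have hzero := heval (fun _ => 0) continuous_const
  simp only [hc0] at hzero
  refine ⟨c', mem_sphere_zero_iff_norm.1 hc', tendsto_nhds_unique hzero tendsto_const_nhds,
    fun a b t ht => ?_, fun a b t ht => ?_⟩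
  · refine hle (fun r => ![Real.exp (-r * t) * (b + (a - b) * Real.exp (-t)),
      Real.exp (-r * t) * b]) _ ?_ fun n => hcA n a b t ht
    fun_prop
  · refine hle (fun r => ![Real.exp (-r * t) * a,
      Real.exp (-r * t) * (-a + (b + a) * Real.exp (-t))]) _ ?_ fun n => hcB n a b t ht
    fun_prop

theorem not_sufficientToCheckGUES {U : Set ℝ} (hU : U ⊆ Icc 0 1) (h0 : (0 : ℝ) ∈ U)
    (h1 : (1 : ℝ) ∈ U) (m : ℕ) : ¬ SufficientToCheckGUES U (polyOfDegreeLE m) := by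
  intro hsuff
  obtain ⟨c, hc⟩ := exists_isNormalizedLyapunov_of_tendsto
    (s := Finsupp.equivFunOnFinite.symm fun _ => m)
    (tendsto_one_div_add_atTop_nhds_zero_nat (𝕜 := ℝ)) fun n => by
      have he : (0 : ℝ) < 1 / ((n : ℝ) + 1) := by positivity
      obtain ⟨V, ⟨p, hpm, rfl⟩, hp⟩ := hsuff _ _ ⟨isHurwitz_horizontalMat he,
        isHurwitz_verticalMat he, isGUES_horizontalMat_verticalMat hU he⟩
      obtain ⟨c, rfl⟩ := exists_eq_ofCoeffs hpm
      exact hp.exists_isNormalizedLyapunov h0 h1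
  exact not_isNormalizedLyapunov_zero _ _ hc

end PlanarSwitched

theorem theorem2 (U : Set ℝ) (hU : U = Set.Icc 0 1 ∨ U = {0, 1}) :
    (∀ A B : PlanarSwitched.Mat, (A, B) ∈ PlanarSwitched.XiGUES U →
      IsLeast (PlanarSwitched.polyCLFDegrees U A B) (PlanarSwitched.minDegree U A B)) ∧
    (¬ ∃ m : ℕ, ∀ A B : PlanarSwitched.Mat, (A, B) ∈ PlanarSwitched.XiGUES U →
      PlanarSwitched.minDegree U A B ≤ m) ∧
    (∀ m : ℕ, ¬ PlanarSwitched.SufficientToCheckGUES U (PlanarSwitched.polyOfDegreeLE m)) := by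
  obtain ⟨hsub, h0, h1⟩ : U ⊆ Set.Icc 0 1 ∧ (0 : ℝ) ∈ U ∧ (1 : ℝ) ∈ U := by
    rcases hU with rfl | rfl
    · simp
    · refine ⟨?_, by simp, by simp⟩
      rintro x (rfl | rfl) <;> simp
  have hleast : ∀ A B : PlanarSwitched.Mat, (A, B) ∈ PlanarSwitched.XiGUES U →
      IsLeast (PlanarSwitched.polyCLFDegrees U A B) (PlanarSwitched.minDegree U A B) := by
    intro A B hAB
    obtain ⟨p, hp⟩ := PlanarSwitched.exists_polynomial_isCLF hsub h0 h1 hAB.2.2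
    exact ⟨Nat.sInf_mem ⟨_, p, hp, rfl⟩, fun d hd => Nat.sInf_le hd⟩
  have hnot := PlanarSwitched.not_sufficientToCheckGUES hsub h0 h1
  refine ⟨hleast, ?_, hnot⟩
  -- Since the minimum is attained, a uniform bound m would make degree m sufficient.
  rintro ⟨m, hm⟩
  refine hnot m fun A B hAB => ?_
  obtain ⟨p, hp, hdeg⟩ := (hleast A B hAB).1
  exact ⟨_, ⟨p, hdeg.trans_le (hm A B hAB), rfl⟩, hp⟩
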